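/- Let $Z$ be a smooth manifold (Hausdorff, second countable, without boundary) with 2-jet bundle $J^2(Z)$, the vector bundle whose fibre in a chart consists of the coordinate 2-jets $(r,p,A)=(u,Du,D^2u)$. For $z\in Z$ regard $\mathrm{Sym}^2(T_z^*Z)\subset J^2_z(Z)$ as the 2-jets $(0,0,A)$ of functions with critical value zero at $z$. A *subequation* on $Z$ is a closed subset $F\subset J^2(Z)$ such that $F_z+P\subset F_z$ for every $z\in Z$ and every quadratic form $P\ge 0$ on $T_zZ$, where $F_z=F\cap J^2_z(Z)$; it has the *cone property* if $tF_z\subset F_z$ for all $z\in Z$ and $t>0$. Put $(F_z)_0=F_z\cap \mathrm{Sym}^2(T_z^*Z)$. A submanifold $X\subset Z$ is *totally $F$-free* if for each $x\in X$ there is an $A\in (F_x)_0$ whose restriction to $T_xX$ is negative definite. A $C^2$ function $f$ on an open set $U\subset Z$ is *strictly $F$-subharmonic* if its 2-jet at each point of $U$ lies in $\mathrm{Int}\,F$, the interior of $F$ in $J^2(Z)$. **Theorem.** Let $F$ be a subequation on $Z$ with the cone property, and let $X\subset Z$ be a closed (smooth, embedded) totally $F$-free submanifold. Assume that $\mathrm{Int}\,(F_x)_0\subset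 \mathrm{Int}\,F$ for each $x\in X$, where $\mathrm{Int}\,(F_x)_0$ is the interior of $(F_x)_0$ in $\mathrm{Sym}^2(T_x^*Z)$. Then for every $u\in C^2(X)$ there are an open neighbourhood $U$ of $X$ in $Z$ and a strictly $F$-subharmonic function $\widetilde u\in C^2(U)$ with $\widetilde u|_X=u$. -/

import Mathlib

open Set Topology Bundle Manifold
open scoped ContDiff

noncomputable section

/-! ### Symmetric forms and the fibre of the 2-jet bundle -/

/-- Subspaces of a real normed space. This only abbreviates `Submodule ℝ V`; it makes the instances
on `V` be found through its norm. -/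
abbrev NormedSubspace (V : Type*) [NormedAddCommGroup V] [NormedSpace ℝ V] : Type _ :=
  Submodule ℝ V

/-- The space of symmetric bilinear forms (equivalently, quadratic forms) on `E`. -/
def SymForm (E : Type*) [NormedAddCommGroup E] [NormedSpace ℝ E] :
    NormedSubspace (E →L[ℝ] E →L[ℝ] ℝ) where
  carrier := {A | ∀ v w, A v w = A w v}
  add_mem' := by
    intro A B hA hB v w
    simp [hA v w, hB v w]
  zero_mem' := by
    intro v w
    simp
  smul_mem' := by
    intro c A hA v w
    simp [hA v w]

/-- Symmetrization of a bilinear form; it fixes the symmetric ones. It is applied below to second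
derivatives of `C²` functions, which are already symmetric. -/
def SymForm.symm {E : Type*} [NormedAddCommGroup E] [NormedSpace ℝ E] :
    (E →L[ℝ] E →L[ℝ] ℝ) →ₗ[ℝ] SymForm E where
  toFun A := ⟨(2⁻¹ : ℝ) • (A + A.flip), by
    intro v w
    change (2⁻¹ : ℝ) * (A v w + A w v) = (2⁻¹ : ℝ) * (A w v + A v w)
    ring⟩
  map_add' A B := by
    ext v w
    change (2⁻¹ : ℝ) * (A v w + B v w + (A w v + B w v)) =
      (2⁻¹ : ℝ) * (A v w + A w v) + (2⁻¹ : ℝ) * (B v w + B w v)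
    ring
  map_smul' c A := by
    ext v w
    change (2⁻¹ : ℝ) * (c * A v w + c * A w v) = c * ((2⁻¹ : ℝ) * (A v w + A w v))
    ring

theorem SymForm.coe_symm_apply {E : Type*} [NormedAddCommGroup E] [NormedSpace ℝ E]
    (A : E →L[ℝ] E →L[ℝ] ℝ) (v w : E) :
    (SymForm.symm A).1 v w = 2⁻¹ * (A v w + A w v) := rfl

theorem SymForm.symm_of_mem {E : Type*} [NormedAddCommGroup E] [NormedSpace ℝ E]
    (A : SymForm E) : SymForm.symm A.1 = A := by
  apply Subtype.ext
  ext v w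
  rw [SymForm.coe_symm_apply, A.2 w v]
  ring

/-- The fibre `ℝ × E* × Sym²(E*)` of the 2-jets `(r, p, A)` in a chart with values in `E`. -/
abbrev JetModel (E : Type*) [NormedAddCommGroup E] [NormedSpace ℝ E] : Type _ :=
  ℝ × (E →L[ℝ] ℝ) × SymForm E

/-- The coordinate 2-jet at `y` of a function `f` on a vector space: value, first derivative and
second derivative. -/
def coordJet {E : Type*} [NormedAddCommGroup E] [NormedSpace ℝ E] (f : E → ℝ) (y : E) :
    JetModel E :=
  (f y, fderiv ℝ f y, SymForm.symm (fderiv ℝ (fderiv ℝ f) y))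

section

variable {E : Type*} [NormedAddCommGroup E] [NormedSpace ℝ E] [FiniteDimensional ℝ E]

/-- The action on 2-jets of a change of variables with first derivative `B` and second
derivative `C`: `(r, p, A) ↦ (r, p ∘ B, A(B ·, B ·) + p ∘ C)`, by the chain rule. -/
def jetPull (B : E →L[ℝ] E) (C : E →L[ℝ] E →L[ℝ] E) : JetModel E →L[ℝ] JetModel E :=
  LinearMap.toContinuousLinearMap
    { toFun := fun J => (J.1, J.2.1.comp B, SymForm.symm
        (J.2.2.1.bilinearComp B B + (ContinuousLinearMap.compL ℝ E E ℝ J.2.1).comp C))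
      map_add' := by
        intro J K
        refine Prod.ext rfl (Prod.ext ?_ (Subtype.ext ?_))
        · ext v
          simp
        · ext v w
          change (2⁻¹ : ℝ) * (J.2.2.1 (B v) (B w) + K.2.2.1 (B v) (B w) +
              (J.2.1 (C v w) + K.2.1 (C v w)) + (J.2.2.1 (B w) (B v) + K.2.2.1 (B w) (B v) +
              (J.2.1 (C w v) + K.2.1 (C w v)))) =
            (2⁻¹ : ℝ) * (J.2.2.1 (B v) (B w) + J.2.1 (C v w) +
              (J.2.2.1 (B w) (B v) + J.2.1 (C w v))) +
            (2⁻¹ : ℝ) * (K.2.2.1 (B v) (B w) + K.2.1 (C v w) +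
              (K.2.2.1 (B w) (B v) + K.2.1 (C w v)))
          ring
      map_smul' := by
        intro c J
        refine Prod.ext rfl (Prod.ext ?_ (Subtype.ext ?_))
        · ext v
          simp
        · ext v w
          change (2⁻¹ : ℝ) * (c * J.2.2.1 (B v) (B w) + c * J.2.1 (C v w) +
              (c * J.2.2.1 (B w) (B v) + c * J.2.1 (C w v))) =
            c * ((2⁻¹ : ℝ) * (J.2.2.1 (B v) (B w) + J.2.1 (C v w) +
              (J.2.2.1 (B w) (B v) + J.2.1 (C w v))))
          ring }

theorem jetPull_apply (B : E →L[ℝ] E) (C : E →L[ℝ] E →L[ℝ] E) (J : JetModel E) :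
    jetPull B C J = (J.1, J.2.1.comp B, SymForm.symm
      (J.2.2.1.bilinearComp B B + (ContinuousLinearMap.compL ℝ E E ℝ J.2.1).comp C)) := rfl

theorem jetPull_form_apply (B : E →L[ℝ] E) (C : E →L[ℝ] E →L[ℝ] E) (J : JetModel E) (v w : E) :
    (jetPull B C J).2.2.1 v w = 2⁻¹ * (J.2.2.1 (B v) (B w) + J.2.1 (C v w) +
      (J.2.2.1 (B w) (B v) + J.2.1 (C w v))) := rfl

/-- The 2-jet change of coordinates of a map `ψ : E → E` at `y`. -/
def jetChange (ψ : E → E) (y : E) : JetModel E →L[ℝ] JetModel E :=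
  jetPull (fderiv ℝ ψ y) (fderiv ℝ (fderiv ℝ ψ) y)

theorem jetChange_congr {ψ φ : E → E} {y : E} (h : ψ =ᶠ[𝓝 y] φ) :
    jetChange ψ y = jetChange φ y := by
  unfold jetChange
  rw [h.fderiv_eq, h.fderiv.fderiv_eq]

theorem jetChange_id (y : E) (J : JetModel E) : jetChange (fun x : E => x) y J = J := by
  have h : fderiv ℝ (fun x : E => x) = fun _ => ContinuousLinearMap.id ℝ E := by
    ext x v
    simp
  unfold jetChange
  rw [h, jetPull_apply]
  refine Prod.ext rfl (Prod.ext ?_ (Subtype.ext ?_))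
  · ext v
    simp
  · ext v w
    simp [SymForm.coe_symm_apply, J.2.2.2 w v]
    ring

/-- Second-order chain rule. -/
theorem fderiv_fderiv_comp_apply {E : Type*} [NormedAddCommGroup E] [NormedSpace ℝ E]
    {G : Type*} [NormedAddCommGroup G] [NormedSpace ℝ G]
    {f : E → G} {g : E → E} {y : E} (hf : ContDiffAt ℝ 2 f (g y)) (hg : ContDiffAt ℝ 2 g y)
    (v w : E) :
    fderiv ℝ (fderiv ℝ (f ∘ g)) y v w =
      fderiv ℝ (fderiv ℝ f) (g y) (fderiv ℝ g y v) (fderiv ℝ g y w) +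
        fderiv ℝ f (g y) (fderiv ℝ (fderiv ℝ g) y v w) := by
  have e : fderiv ℝ (f ∘ g) =ᶠ[𝓝 y] fun x => (fderiv ℝ f (g x)).comp (fderiv ℝ g x) := by
    have h1 : ∀ᶠ x in 𝓝 y, ContDiffAt ℝ 2 g x := hg.eventually (by simp)
    have h2 : ∀ᶠ x in 𝓝 y, ContDiffAt ℝ 2 f (g x) :=
      hg.continuousAt.eventually (hf.eventually (by simp))
    filter_upwards [h1, h2] with x hx1 hx2
    exact fderiv_comp x (hx2.differentiableAt (by simp)) (hx1.differentiableAt (by simp))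
  have df : DifferentiableAt ℝ (fderiv ℝ f) (g y) :=
    (hf.fderiv_right (m := 1) (by norm_num)).differentiableAt (by simp)
  have dg : DifferentiableAt ℝ (fderiv ℝ g) y :=
    (hg.fderiv_right (m := 1) (by norm_num)).differentiableAt (by simp)
  have dg0 : DifferentiableAt ℝ g y := hg.differentiableAt (by simp)
  have h : HasFDerivAt (fun x => fderiv ℝ f (g x))
      ((fderiv ℝ (fderiv ℝ f) (g y)).comp (fderiv ℝ g y)) y :=
    HasFDerivAt.comp y df.hasFDerivAt dg0.hasFDerivAt
  rw [e.fderiv_eq, (h.clm_comp dg.hasFDerivAt).fderiv]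
  simp [add_comm]

/-- Functoriality of the 2-jet change of coordinates. -/
theorem jetChange_comp {f g : E → E} {y : E} (hf : ContDiffAt ℝ 2 f (g y))
    (hg : ContDiffAt ℝ 2 g y) (J : JetModel E) :
    jetChange g y (jetChange f (g y) J) = jetChange (f ∘ g) y J := by
  have h1 : fderiv ℝ (f ∘ g) y = (fderiv ℝ f (g y)).comp (fderiv ℝ g y) :=
    fderiv_comp y (hf.differentiableAt (by simp)) (hg.differentiableAt (by simp))
  unfold jetChange
  refine Prod.ext rfl (Prod.ext ?_ (Subtype.ext ?_))
  · ext v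
    simp [jetPull_apply, h1]
  · ext v w
    rw [jetPull_form_apply, jetPull_form_apply, jetPull_form_apply, jetPull_form_apply,
      fderiv_fderiv_comp_apply hf hg, fderiv_fderiv_comp_apply hf hg, h1]
    simp only [jetPull_apply, ContinuousLinearMap.comp_apply, map_add]
    ring

theorem continuousOn_jetChange {f : E → E} {s : Set E} (hs : IsOpen s)
    (hf : ContDiffOn ℝ 2 f s) : ContinuousOn (jetChange f) s := by
  have c1 : ContinuousOn (fderiv ℝ f) s := hf.continuousOn_fderiv_of_isOpen hs (by simp)
  have c2 : ContinuousOn (fderiv ℝ (fderiv ℝ f)) s :=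
    (hf.fderiv_of_isOpen (m := 1) hs (by norm_num)).continuousOn_fderiv_of_isOpen hs (by simp)
  refine (continuousOn_clm_apply (𝕜 := ℝ) (E := JetModel E) (F := JetModel E)).2 fun J => ?_
  refine continuousOn_const.prodMk ((continuousOn_const.clm_comp c1).prodMk
    (IsInducing.subtypeVal.continuousOn_iff.2 ?_))
  refine (continuousOn_clm_apply (𝕜 := ℝ) (E := E) (F := E →L[ℝ] ℝ)).2 fun v => ?_
  refine (continuousOn_clm_apply (𝕜 := ℝ) (E := E) (F := ℝ)).2 fun w => ?_
  have c1' (v : E) := c1.clm_apply (continuousOn_const (c := v))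
  have c2' (v w : E) :=
    (c2.clm_apply (continuousOn_const (c := v))).clm_apply (continuousOn_const (c := w))
  have c3 (v w : E) : ContinuousOn (fun y => J.2.2.1 (fderiv ℝ f y v) (fderiv ℝ f y w) +
      J.2.1 (fderiv ℝ (fderiv ℝ f) y v w)) s :=
    ((J.2.2.1.continuous.comp_continuousOn (c1' v)).clm_apply (c1' w)).add
      (J.2.1.continuous.comp_continuousOn (c2' v w))
  exact continuousOn_const.mul ((c3 v w).add (c3 w v))

end

/-! ### The 2-jet bundle of a manifold -/

section

variable (E : Type*) [NormedAddCommGroup E] [NormedSpace ℝ E]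
  (Z : Type*) [TopologicalSpace Z] [ChartedSpace E Z] [IsManifold 𝓘(ℝ, E) ∞ Z]

theorem contDiffOn_transition (i j : atlas E Z) :
    ContDiffOn ℝ 2 (i.1 ∘ j.1.symm) (j.1.symm.trans i.1).source := by
  have h := (contDiffGroupoid ∞ 𝓘(ℝ, E)).compatible j.2 i.2
  have h' := (contDiffGroupoid_le (I := 𝓘(ℝ, E)) (m := 2) (n := ∞)
    ENat.LEInfty.out) h
  rw [contDiffGroupoid] at h'
  have h2 := (mem_groupoid_of_pregroupoid.1 h').1
  simpa [contDiffPregroupoid] using h2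

theorem contDiffAt_transition (i j : atlas E Z) {z : Z} (hi : z ∈ i.1.source)
    (hj : z ∈ j.1.source) : ContDiffAt ℝ 2 (i.1 ∘ j.1.symm) (j.1 z) := by
  refine (contDiffOn_transition E Z i j).contDiffAt
    ((OpenPartialHomeomorph.open_source _).mem_nhds ?_)
  simp [hi, hj]

variable [FiniteDimensional ℝ E]

/-- The bundle of 2-jets of real functions on the manifold `Z`: in each chart of the atlas it is
trivialized with fibre `ℝ × E* × Sym²(E*)`, and two charts are glued by the chain rule to
second order. As for the tangent bundle, the fibre at `z` is identified with the model fibre through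
the preferred chart at `z`. -/
def jetBundleCore : VectorBundleCore ℝ Z (JetModel E) (atlas E Z) where
  baseSet i := i.1.source
  isOpen_baseSet i := i.1.open_source
  indexAt := achart E
  mem_baseSet_at := mem_chart_source E
  coordChange i j z := jetChange (i.1 ∘ j.1.symm) (j.1 z)
  coordChange_self := by
    intro i z hz J
    have h : i.1 ∘ i.1.symm =ᶠ[𝓝 (i.1 z)] fun x => x := by
      filter_upwards [i.1.open_target.mem_nhds (i.1.map_source hz)] with y hy
      exact i.1.right_inv hy
    rw [jetChange_congr h, jetChange_id]
  continuousOn_coordChange := by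
    intro i j
    refine (continuousOn_jetChange (OpenPartialHomeomorph.open_source _)
      (contDiffOn_transition E Z i j)).comp (j.1.continuousOn.mono inter_subset_right) ?_
    intro z hz
    simp [hz.1, hz.2]
  coordChange_comp := by
    rintro i j k z ⟨⟨hi, hj⟩, hk⟩ J
    have hjk : (j.1 ∘ k.1.symm) (k.1 z) = j.1 z := by simp [hk]
    have h : (i.1 ∘ j.1.symm) ∘ (j.1 ∘ k.1.symm) =ᶠ[𝓝 (k.1 z)] i.1 ∘ k.1.symm := by
      have : ∀ᶠ y in 𝓝 (k.1 z), k.1.symm y ∈ j.1.source :=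
        (k.1.continuousAt_symm (k.1.map_source hk)).eventually
          (j.1.open_source.mem_nhds (by simpa [hk] using hj))
      filter_upwards [this] with y hy
      simp [j.1.left_inv hy]
    rw [← jetChange_congr h, ← jetChange_comp, hjk]
    · rw [hjk]
      exact contDiffAt_transition E Z i j hi hj
    · exact contDiffAt_transition E Z j k hj hk

/-- The fibre `J²_z(Z)` of 2-jets at `z`, a finite-dimensional real vector space. -/
abbrev JetFiber (z : Z) : Type _ := (jetBundleCore E Z).Fiber z

/-- The total space of the 2-jet bundle `J²(Z)`, with its topology of a vector bundle. -/
abbrev JetBundle : Type _ := (jetBundleCore E Z).TotalSpace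

variable {Z}

/-- The 2-jet at `z` of a function `f : Z → ℝ` which is `C²` near `z`. -/
def jetAt (f : Z → ℝ) (z : Z) : JetFiber E Z z :=
  coordJet (f ∘ (chartAt E z).symm) (chartAt E z z)

/-- The embedding `Sym²(T_z^* Z) → J²_z(Z)`, `A ↦ (0, 0, A)`, onto the 2-jets of functions with
critical value zero at `z`. As in Mathlib, the tangent space `T_z Z` is `E`, identified through the
preferred chart at `z`, which is also the one used for the fibre of the 2-jet bundle. -/
def symJet (z : Z) (A : SymForm E) : JetFiber E Z z :=
  ((0, 0, A) : JetModel E)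

/-- The fibre `F_z` of a subset `F` of the 2-jet bundle. -/
def jetSlice (F : Set (JetBundle E Z)) (z : Z) : Set (JetFiber E Z z) :=
  {J | (⟨z, J⟩ : JetBundle E Z) ∈ F}

/-- `(F_z)_0 = F_z ∩ Sym²(T_z^* Z)`. -/
def symSlice (F : Set (JetBundle E Z)) (z : Z) : Set (SymForm E) :=
  {A | symJet E z A ∈ jetSlice E F z}

/-- A subequation: a closed subset `F` of the 2-jet bundle such that `F_z + P ⊆ F_z` for every
quadratic form `P ≥ 0` on `T_z Z`. -/
structure IsSubequation (F : Set (JetBundle E Z)) : Prop where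
  isClosed : IsClosed F
  positivity : ∀ (z : Z), ∀ J ∈ jetSlice E F z, ∀ P : SymForm E,
    (∀ v, 0 ≤ P.1 v v) → J + symJet E z P ∈ jetSlice E F z

/-- The cone property: each fibre is a cone with vertex at the origin. -/
def HasConeProperty (F : Set (JetBundle E Z)) : Prop :=
  ∀ (z : Z), ∀ J ∈ jetSlice E F z, ∀ t : ℝ, 0 < t → t • J ∈ jetSlice E F z

/-- A `C²` function `f` on an open set `U` is strictly `F`-subharmonic if its 2-jet at each point of
`U` lies in the interior of `F` in the total space of the 2-jet bundle. -/
structure IsStrictlySubharmonicOn (F : Set (JetBundle E Z)) (f : Z → ℝ) (U : Set Z) : Prop where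
  contMDiffOn : ContMDiffOn 𝓘(ℝ, E) 𝓘(ℝ, ℝ) 2 f U
  jet_mem : ∀ z ∈ U, (⟨z, jetAt E f z⟩ : JetBundle E Z) ∈ interior F

/-- A subspace `W` is totally free for a set `F₀` of quadratic forms if some element of `F₀` is
negative definite on `W` (that is, `W` is `F₀`-Morse). -/
def IsTotallyFreeSubspace {T : Type*} [NormedAddCommGroup T] [NormedSpace ℝ T]
    (F₀ : Set (SymForm T)) (W : Submodule ℝ T) : Prop :=
  ∃ A ∈ F₀, ∀ w ∈ W, w ≠ 0 → A.1 w w < 0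

/-- An immersed manifold `i : X → Z` is totally `F`-free if each tangent space `T_x X`, that is, the
image of the differential of `i` at `x`, is totally `(F_{i x})_0`-free. -/
def IsTotallyFree (F : Set (JetBundle E Z)) {E' : Type*} [NormedAddCommGroup E']
    [NormedSpace ℝ E'] {X : Type*} [TopologicalSpace X] [ChartedSpace E' X] (i : X → Z) : Prop :=
  ∀ x : X, IsTotallyFreeSubspace (symSlice E F (i x))
    (LinearMap.range (mfderiv 𝓘(ℝ, E') 𝓘(ℝ, E) i x).toLinearMap)

end

end

/-! Write `X` for the image of `i`. Extend `u` to a `C²` function `w` on `Z`, and construct a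
substitute `g` for the squared distance to `X`: along `X` its 2-jet is `(0, 0, P)` with `P ≥ 0` and
`ker P ⊆ T_x X`. The solution is `w + l g` for a sufficiently large function `l`.

If `A ∈ (F_x)_0` is negative definite on `T_x X`, then `c P - A` is positive definite for large `c`
(`exists_smul_sub_posDef`). Every form `B` near `c P` is thus `A` plus a nonnegative form, so
positivity puts `B` in `(F_x)_0`. Dividing by `c`, the cone property makes `P` interior to `(F_x)_0`
(`mem_interior_symSlice`), and the hypothesis on interiors puts the 2-jet of `g` in `Int F`.

Along `X` the 2-jet of `w + l g` is `J(w) + l J(g)`, a positive multiple of `J(g) + l⁻¹ J(w)`, which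
lies in `Int F` once `l` is large. A suitable `l` is glued from local constants
(`exists_contMDiff_add_smul_jetAt_mem`). As 2-jets vary continuously and `Int F` is open, the
condition persists on a neighbourhood of `X`. -/

section

/-! ### 2-jets in coordinates -/

variable {E : Type*} [NormedAddCommGroup E] [NormedSpace ℝ E]

theorem coordJet_congr {f g : E → ℝ} {y : E} (h : f =ᶠ[𝓝 y] g) : coordJet f y = coordJet g y := by
  unfold coordJet
  rw [h.eq_of_nhds, h.fderiv_eq, h.fderiv.fderiv_eq]

theorem differentiableAt_fderiv {G : Type*} [NormedAddCommGroup G] [NormedSpace ℝ G]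
    {f : E → G} {y : E} (hf : ContDiffAt ℝ 2 f y) : DifferentiableAt ℝ (fderiv ℝ f) y :=
  (hf.fderiv_right (m := 1) (by norm_num)).differentiableAt (by simp)

theorem eventually_differentiableAt {G : Type*} [NormedAddCommGroup G] [NormedSpace ℝ G]
    {f : E → G} {y : E} (hf : ContDiffAt ℝ 2 f y) : ∀ᶠ x in 𝓝 y, DifferentiableAt ℝ f x := by
  filter_upwards [hf.eventually (by simp)] with x hx using hx.differentiableAt (by simp)

theorem coordJet_add {f g : E → ℝ} {y : E} (hf : ContDiffAt ℝ 2 f y) (hg : ContDiffAt ℝ 2 g y) :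
    coordJet (fun x => f x + g x) y = coordJet f y + coordJet g y := by
  have e : fderiv ℝ (fun x => f x + g x) =ᶠ[𝓝 y] fun x => fderiv ℝ f x + fderiv ℝ g x := by
    filter_upwards [eventually_differentiableAt hf, eventually_differentiableAt hg]
      with x hx1 hx2 using fderiv_fun_add hx1 hx2
  unfold coordJet
  rw [e.fderiv_eq, e.eq_of_nhds,
    fderiv_fun_add (differentiableAt_fderiv hf) (differentiableAt_fderiv hg), map_add]
  rfl

/-- Multiplying a function with critical value zero by `f` multiplies its 2-jet by the value
of `f`. -/
theorem coordJet_mul_of_critical {f g : E → ℝ} {y : E} (hf : ContDiffAt ℝ 2 f y)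
    (hg : ContDiffAt ℝ 2 g y) (h0 : g y = 0) (h1 : fderiv ℝ g y = 0) :
    coordJet (fun x => f x * g x) y = f y • coordJet g y := by
  have e : fderiv ℝ (fun x => f x * g x) =ᶠ[𝓝 y]
      fun x => f x • fderiv ℝ g x + g x • fderiv ℝ f x := by
    filter_upwards [eventually_differentiableAt hf, eventually_differentiableAt hg]
      with x hx1 hx2 using fderiv_fun_mul hx1 hx2
  have df := hf.differentiableAt (by simp)
  have dg := hg.differentiableAt (by simp)
  have h2 := ((df.hasFDerivAt.smul (differentiableAt_fderiv hg).hasFDerivAt).add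
    (dg.hasFDerivAt.smul (differentiableAt_fderiv hf).hasFDerivAt)).fderiv
  -- Of the four terms of the product rule only `f D²g` survives, the others containing `g y` or `Dg
  -- y`.
  have h3 : fderiv ℝ (fun x => f x • fderiv ℝ g x + g x • fderiv ℝ f x) y =
      f y • fderiv ℝ (fderiv ℝ g) y := by
    refine h2.trans ?_
    ext v w
    simp [h0, h1]
  unfold coordJet
  rw [e.fderiv_eq, e.eq_of_nhds, h3, h0, h1, map_smul]
  refine Prod.ext ?_ (Prod.ext ?_ rfl) <;> simp [h0]

/-- The 2-jet of `‖N‖²` at a zero of `N`. -/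
theorem coordJet_norm_sq {G : Type*} [NormedAddCommGroup G] [InnerProductSpace ℝ G]
    {N : E → G} {y : E} (hN : ContDiffAt ℝ 2 N y) (h0 : N y = 0) :
    ∃ P : SymForm E, coordJet (fun x => ‖N x‖ ^ 2) y = (0, 0, P) ∧
      ∀ v, P.1 v v = 2 * ‖fderiv ℝ N y v‖ ^ 2 := by
  have e : fderiv ℝ (fun x => ‖N x‖ ^ 2) =ᶠ[𝓝 y]
      fun x => (2 : ℝ) • (innerSL ℝ (N x)).comp (fderiv ℝ N x) := by
    filter_upwards [eventually_differentiableAt hN] with x hx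
    rw [hx.hasFDerivAt.norm_sq.fderiv]
    ext v
    simp
  refine ⟨SymForm.symm (fderiv ℝ (fderiv ℝ (fun x => ‖N x‖ ^ 2)) y), ?_, fun v => ?_⟩
  · unfold coordJet
    rw [e.eq_of_nhds]
    simp [h0]
  · have hd := differentiableAt_fderiv (hN.norm_sq ℝ)
    have h1 : fderiv ℝ (fderiv ℝ (fun x => ‖N x‖ ^ 2)) y v v =
        fderiv ℝ (fun x => fderiv ℝ (fun x => ‖N x‖ ^ 2) x v) y v := by
      rw [fderiv_clm_apply hd (differentiableAt_const v)]
      simp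
    have e' : (fun x => fderiv ℝ (fun x => ‖N x‖ ^ 2) x v) =ᶠ[𝓝 y]
        fun x => (2 : ℝ) * inner ℝ (N x) (fderiv ℝ N x v) := by
      filter_upwards [e] with x hx
      rw [hx]
      simp
    have hv : DifferentiableAt ℝ (fun x => fderiv ℝ N x v) y :=
      (differentiableAt_fderiv hN).clm_apply (differentiableAt_const v)
    have hN1 := hN.differentiableAt (n := 2) (by simp)
    -- The term with the second derivative of `N` is paired with `N y = 0`.
    rw [SymForm.coe_symm_apply, h1, e'.fderiv_eq, fderiv_const_mul (hN1.inner ℝ hv),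
      smul_apply, fderiv_inner_apply ℝ hN1 hv, h0, inner_zero_left, real_inner_self_eq_norm_sq,
      smul_eq_mul]
    ring

theorem continuousAt_coordJet {f : E → ℝ} {y : E} (hf : ContDiffAt ℝ 2 f y) :
    ContinuousAt (coordJet f) y := by
  have h1 : ContDiffAt ℝ 1 (fderiv ℝ f) y := hf.fderiv_right (m := 1) (by norm_num)
  have h2 : ContinuousAt (fderiv ℝ (fderiv ℝ f)) y :=
    (h1.fderiv_right (m := 0) (by norm_num)).continuousAt
  refine hf.continuousAt.prodMk (h1.continuousAt.prodMk ?_)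
  refine IsInducing.subtypeVal.continuousAt_iff.2 ?_
  exact (h2.add ((ContinuousLinearMap.flipₗᵢ ℝ E E ℝ).continuous.continuousAt.comp h2)).const_smul
    (2⁻¹ : ℝ)

variable [FiniteDimensional ℝ E]

/-- The gluing maps of the jet bundle match the coordinate 2-jets of one function in two charts, so
its 2-jets form a section. -/
theorem coordJet_comp {f : E → ℝ} {ψ : E → E} {y : E} (hf : ContDiffAt ℝ 2 f (ψ y))
    (hψ : ContDiffAt ℝ 2 ψ y) :
    coordJet (f ∘ ψ) y = jetChange ψ y (coordJet f (ψ y)) := by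
  unfold jetChange
  refine Prod.ext rfl (Prod.ext ?_ (Subtype.ext ?_))
  · exact fderiv_comp y (hf.differentiableAt (by simp)) (hψ.differentiableAt (by simp))
  · ext v w
    have hs : ∀ v w, fderiv ℝ (fderiv ℝ f) (ψ y) v w = fderiv ℝ (fderiv ℝ f) (ψ y) w v := by
      intro v w
      exact (hf.isSymmSndFDerivAt (by simp)) v w
    rw [jetPull_form_apply]
    simp only [coordJet, SymForm.coe_symm_apply]
    rw [fderiv_fderiv_comp_apply hf hψ, fderiv_fderiv_comp_apply hf hψ, hs (fderiv ℝ ψ y w)]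
    ring

end

/-! ### 2-jets of functions on the manifold -/

section

variable {E : Type*} [NormedAddCommGroup E] [NormedSpace ℝ E]
  {Z : Type*} [TopologicalSpace Z] [ChartedSpace E Z] [IsManifold 𝓘(ℝ, E) ∞ Z]

theorem contDiffAt_comp_chart_symm {G : Type*} [NormedAddCommGroup G] [NormedSpace ℝ G]
    {f : Z → G} {z : Z} (hf : ContMDiffAt 𝓘(ℝ, E) 𝓘(ℝ, G) 2 f z) {e : OpenPartialHomeomorph Z E}
    (he : e ∈ atlas E Z) (hz : z ∈ e.source) :
    ContDiffAt ℝ 2 (f ∘ e.symm) (e z) := by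
  have := (contMDiffOn_symm_of_mem_maximalAtlas (I := 𝓘(ℝ, E)) (n := ∞)
    (IsManifold.subset_maximalAtlas he)).contMDiffAt (e.open_target.mem_nhds (e.map_source hz))
  rw [← contMDiffAt_iff_contDiffAt]
  refine ContMDiffAt.comp (e z) ?_ (this.of_le ENat.LEInfty.out)
  rwa [e.left_inv hz]

variable [FiniteDimensional ℝ E]

theorem jetAt_congr {f g : Z → ℝ} {z : Z} (h : f =ᶠ[𝓝 z] g) : jetAt E f z = jetAt E g z := by
  apply coordJet_congr
  have := (chartAt E z).continuousAt_symm (mem_chart_target E z)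
  rw [ContinuousAt, (chartAt E z).left_inv (mem_chart_source E z)] at this
  exact this.eventually h

theorem eq_zero_of_jetAt_eq_symJet {g : Z → ℝ} {z : Z} {A : SymForm E}
    (h : jetAt E g z = symJet E z A) : g z = 0 := by
  have h0 : (g ∘ (chartAt E z).symm) (chartAt E z z) = 0 := congrArg Prod.fst h
  rwa [Function.comp_apply, (chartAt E z).left_inv (mem_chart_source E z)] at h0

theorem jetAt_add {f g : Z → ℝ} {z : Z} (hf : ContMDiffAt 𝓘(ℝ, E) 𝓘(ℝ, ℝ) 2 f z)
    (hg : ContMDiffAt 𝓘(ℝ, E) 𝓘(ℝ, ℝ) 2 g z) :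
    jetAt E (fun y => f y + g y) z = jetAt E f z + jetAt E g z :=
  coordJet_add (contDiffAt_comp_chart_symm hf (chart_mem_atlas E z) (mem_chart_source E z))
    (contDiffAt_comp_chart_symm hg (chart_mem_atlas E z) (mem_chart_source E z))

/-- Partition functions and the multiplier `l` therefore act on such 2-jets as scalars: their own
derivatives do not enter. -/
theorem jetAt_mul_of_critical {f g : Z → ℝ} {z : Z} (hf : ContMDiffAt 𝓘(ℝ, E) 𝓘(ℝ, ℝ) 2 f z)
    (hg : ContMDiffAt 𝓘(ℝ, E) 𝓘(ℝ, ℝ) 2 g z) {P : SymForm E} (h : jetAt E g z = symJet E z P) :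
    jetAt E (fun y => f y * g y) z = f z • jetAt E g z := by
  have h' : coordJet (g ∘ (chartAt E z).symm) (chartAt E z z) = ((0, 0, P) : JetModel E) := h
  have := coordJet_mul_of_critical
    (contDiffAt_comp_chart_symm hf (chart_mem_atlas E z) (mem_chart_source E z))
    (contDiffAt_comp_chart_symm hg (chart_mem_atlas E z) (mem_chart_source E z))
    (congrArg Prod.fst h') (congrArg (fun J => J.2.1) h')
  simp only [Function.comp_apply, (chartAt E z).left_inv (mem_chart_source E z)] at this
  exact this

theorem jetAt_zero (z : Z) : jetAt E (fun _ => 0) z = 0 := by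
  have h : fderiv ℝ (fun _ : E => (0 : ℝ)) = fun _ => 0 := by
    ext x v
    simp
  refine Prod.ext rfl (Prod.ext ?_ ?_)
  · exact congrFun h _
  · change SymForm.symm (fderiv ℝ (fderiv ℝ (fun _ : E => (0 : ℝ))) _) = 0
    rw [h]
    simp

theorem jetAt_sum {ι : Type*} (s : Finset ι) {f : ι → Z → ℝ} {z : Z}
    (hf : ∀ j ∈ s, ContMDiffAt 𝓘(ℝ, E) 𝓘(ℝ, ℝ) 2 (f j) z) :
    jetAt E (fun y => ∑ j ∈ s, f j y) z = ∑ j ∈ s, jetAt E (f j) z := by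
  classical
  induction s using Finset.induction_on with
  | empty => simpa using jetAt_zero z
  | insert a s ha ih =>
    simp only [Finset.sum_insert ha]
    rw [jetAt_add (hf a (by simp)) (contMDiffAt_finsetSum fun j hj => hf j (by simp [hj])),
      ih fun j hj => hf j (by simp [hj])]

theorem jetBundle_trivializationAt_snd (z₀ : Z) (p : JetBundle E Z) :
    (trivializationAt (JetModel E) (jetBundleCore E Z).Fiber z₀ p).2 =
      (jetBundleCore E Z).coordChange (achart E p.1) (achart E z₀) p.1 p.2 := rfl

/-- In the trivialization over a chart, the 2-jet section is given by the coordinate 2-jets. -/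
theorem coordChange_jetAt {f : Z → ℝ} {z z₀ : Z} (hf : ContMDiffAt 𝓘(ℝ, E) 𝓘(ℝ, ℝ) 2 f z)
    (hz : z ∈ (chartAt E z₀).source) :
    (jetBundleCore E Z).coordChange (achart E z) (achart E z₀) z (jetAt E f z) =
      coordJet (f ∘ (chartAt E z₀).symm) (chartAt E z₀ z) := by
  have hψ := contDiffAt_transition E Z (achart E z) (achart E z₀) (mem_chart_source E z) hz
  have hψz : ((chartAt E z) ∘ (chartAt E z₀).symm) (chartAt E z₀ z) = chartAt E z z := by
    simp [(chartAt E z₀).left_inv hz]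
  have hf' := contDiffAt_comp_chart_symm hf (chart_mem_atlas E z) (mem_chart_source E z)
  rw [← hψz] at hf'
  have key := coordJet_comp hf' hψ
  rw [hψz] at key
  refine key.symm.trans (coordJet_congr ?_)
  have : ∀ᶠ y in 𝓝 (chartAt E z₀ z), (chartAt E z₀).symm y ∈ (chartAt E z).source := by
    refine ((chartAt E z₀).continuousAt_symm ((chartAt E z₀).map_source hz)).eventually
      ((chartAt E z).open_source.mem_nhds ?_)
    rw [(chartAt E z₀).left_inv hz]
    exact mem_chart_source E z
  filter_upwards [this] with y hy
  have := (chartAt E z).left_inv hy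
  simp only [Function.comp_apply, this]

/-- Joint continuity in the scalar and the point allows `l⁻¹` to tend to `0` uniformly near a given
point. -/
theorem continuous_smul_jetAt_add_jetAt {f g : Z → ℝ} (hf : ContMDiff 𝓘(ℝ, E) 𝓘(ℝ, ℝ) 2 f)
    (hg : ContMDiff 𝓘(ℝ, E) 𝓘(ℝ, ℝ) 2 g) :
    Continuous fun q : ℝ × Z => (⟨q.2, q.1 • jetAt E f q.2 + jetAt E g q.2⟩ : JetBundle E Z) := by
  refine continuous_iff_continuousAt.2 fun q₀ => ?_
  refine (FiberBundle.continuousAt_totalSpace (JetModel E)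
    (E := (jetBundleCore E Z).Fiber) _).2 ⟨continuousAt_snd, ?_⟩
  have c (h : Z → ℝ) (hh : ContMDiff 𝓘(ℝ, E) 𝓘(ℝ, ℝ) 2 h) : ContinuousAt (fun q : ℝ × Z =>
      coordJet (h ∘ (chartAt E q₀.2).symm) (chartAt E q₀.2 q.2)) q₀ := by
    have h1 := continuousAt_coordJet (contDiffAt_comp_chart_symm (hh q₀.2)
      (chart_mem_atlas E q₀.2) (mem_chart_source E q₀.2))
    have h2 : ContinuousAt (fun q : ℝ × Z => chartAt E q₀.2 q.2) q₀ :=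
      ((chartAt E q₀.2).continuousAt (mem_chart_source E q₀.2)).comp continuousAt_snd
    exact ContinuousAt.comp (f := fun q : ℝ × Z => chartAt E q₀.2 q.2) h1 h2
  refine ((continuousAt_fst.smul (c f hf)).add (c g hg)).congr ?_
  have : ∀ᶠ q : ℝ × Z in 𝓝 q₀, q.2 ∈ (chartAt E q₀.2).source :=
    continuousAt_snd.eventually
      ((chartAt E q₀.2).open_source.mem_nhds (mem_chart_source E q₀.2))
  filter_upwards [this] with q hq
  rw [jetBundle_trivializationAt_snd]
  change _ = (jetBundleCore E Z).coordChange (achart E q.2) (achart E q₀.2) q.2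
    (q.1 • jetAt E f q.2 + jetAt E g q.2)
  refine Eq.symm ((map_add ((jetBundleCore E Z).coordChange (achart E q.2) (achart E q₀.2) q.2)
    _ _).trans (congrArg₂ _ ?_ (coordChange_jetAt (hg _) hq)))
  exact (map_smul ((jetBundleCore E Z).coordChange (achart E q.2) (achart E q₀.2) q.2)
    _ _).trans (congrArg _ (coordChange_jetAt (hf _) hq))

theorem continuous_jetAt {f : Z → ℝ} (hf : ContMDiff 𝓘(ℝ, E) 𝓘(ℝ, ℝ) 2 f) :
    Continuous fun z : Z => (⟨z, jetAt E f z⟩ : JetBundle E Z) := by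
  have := (continuous_smul_jetAt_add_jetAt hf hf).comp
    (continuous_const.prodMk continuous_id : Continuous fun z : Z => ((0 : ℝ), z))
  simpa [Function.comp_def] using this

theorem continuous_jetBundle_smul (t : ℝ) :
    Continuous fun p : JetBundle E Z => (⟨p.1, t • p.2⟩ : JetBundle E Z) := by
  refine continuous_iff_continuousAt.2 fun p₀ => ?_
  have h := (FiberBundle.continuousAt_totalSpace (JetModel E)
    (E := (jetBundleCore E Z).Fiber) _).1
    (continuousAt_id : ContinuousAt (id : JetBundle E Z → JetBundle E Z) p₀)
  refine (FiberBundle.continuousAt_totalSpace (JetModel E)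
    (E := (jetBundleCore E Z).Fiber) _).2 ⟨h.1, ?_⟩
  refine (h.2.const_smul t).congr (Filter.Eventually.of_forall fun p => ?_)
  exact (map_smul ((jetBundleCore E Z).coordChange (achart E p.1) (achart E p₀.1) p.1) t
    p.2).symm

end

/-! ### Totally free subspaces, positivity and interiors -/

section

variable {V : Type*} [NormedAddCommGroup V] [NormedSpace ℝ V] {S : NormedSubspace V} {s : Set S}
  {T : S}

theorem mem_interior_of_norm_sub_lt {ε : ℝ} (hε : 0 < ε)
    (h : ∀ B : S, ‖B.1 - T.1‖ < ε → B ∈ s) : T ∈ interior s := by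
  have hcont : Continuous fun B : S => ‖B.1 - T.1‖ := by fun_prop
  have hmem : T ∈ {B : S | ‖B.1 - T.1‖ < ε} := by simpa using hε
  exact interior_maximal h (isOpen_lt hcont continuous_const) hmem

theorem mem_interior_of_smul_mem_interior {c : ℝ} (hT : c • T ∈ interior s)
    (h : ∀ B : S, c • B ∈ s → B ∈ s) : T ∈ interior s :=
  interior_maximal (fun B hB => h B (interior_subset (s := s) hB))
    (isOpen_interior.preimage (continuous_const_smul c)) hT

end

section

variable {E : Type*} [NormedAddCommGroup E] [NormedSpace ℝ E] [FiniteDimensional ℝ E]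

/-- If `P ≥ 0` and `A` is negative definite on the kernel of `P`, then `c P - A` is positive
definite for large `c`. -/
theorem exists_smul_sub_posDef {A P : E →L[ℝ] E →L[ℝ] ℝ} {W : Submodule ℝ E}
    (hA : ∀ w ∈ W, w ≠ 0 → A w w < 0) (hP : ∀ v, 0 ≤ P v v) (hker : ∀ v, P v v = 0 → v ∈ W) :
    ∃ c > 0, ∃ ε > 0, ∀ v, ε * ‖v‖ ^ 2 ≤ c * P v v - A v v := by
  have hc (B : E →L[ℝ] E →L[ℝ] ℝ) : Continuous fun v => B v v := B.continuous.clm_apply continuous_id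
  have hcont (c : ℝ) : Continuous fun v => c * P v v - A v v := by
    have := hc A
    have := hc P
    fun_prop
  -- On the unit sphere, vectors with `P v v = 0` lie in `W`, where `-A` is positive; elsewhere a
  -- large multiple of `P` dominates. Using `n + 1` keeps the constant positive.
  have hcover : Metric.sphere (0 : E) 1 ⊆ ⋃ n : ℕ, {v | 0 < (n + 1 : ℝ) * P v v - A v v} := by
    intro v hv
    have hv0 : v ≠ 0 := by
      rintro rfl
      simp at hv
    rw [mem_iUnion]
    rcases (hP v).eq_or_lt with h0 | h0
    · refine ⟨0, ?_⟩
      have := hA v (hker v h0.symm) hv0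
      simp [← h0, this]
    · obtain ⟨n, hn⟩ := exists_nat_gt (A v v / P v v)
      refine ⟨n, ?_⟩
      rw [div_lt_iff₀ h0] at hn
      change 0 < (n + 1 : ℝ) * P v v - A v v
      linarith
  have hdir : Directed (· ⊆ ·) fun n : ℕ => {v | 0 < (n + 1 : ℝ) * P v v - A v v} := by
    refine directed_of_isDirected_le fun m n hmn v hv => ?_
    have h1 : (m : ℝ) ≤ n := by exact_mod_cast hmn
    have h2 : 0 < (m + 1 : ℝ) * P v v - A v v := hv
    change 0 < (n + 1 : ℝ) * P v v - A v v
    have := mul_le_mul_of_nonneg_right h1 (hP v)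
    linarith
  obtain ⟨n, hn⟩ := (isCompact_sphere (0 : E) 1).elim_directed_cover _
    (fun n => isOpen_lt continuous_const (hcont _)) hcover hdir
  obtain ⟨ε, hε, h⟩ := (isCompact_sphere (0 : E) 1).exists_forall_le'
    (hcont (n + 1)).continuousOn (a := 0) hn
  refine ⟨n + 1, by positivity, ε, hε, fun v => ?_⟩
  rcases eq_or_ne v 0 with rfl | hv
  · simp
  have hv' : 0 < ‖v‖ := norm_pos_iff.2 hv
  have h1 := h (‖v‖⁻¹ • v) (by simp [norm_smul, hv'.ne'])
  simp only [map_smul, smul_apply, smul_eq_mul] at h1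
  have h2 := mul_le_mul_of_nonneg_right h1 (sq_nonneg ‖v‖)
  refine h2.trans_eq ?_
  field_simp

variable {Z : Type*} [TopologicalSpace Z] [ChartedSpace E Z] [IsManifold 𝓘(ℝ, E) ∞ Z]

theorem symJet_add (z : Z) (A B : SymForm E) : symJet E z (A + B) = symJet E z A + symJet E z B := by
  refine Prod.ext ?_ (Prod.ext ?_ rfl)
  · exact (add_zero (0 : ℝ)).symm
  · exact (add_zero (0 : E →L[ℝ] ℝ)).symm

theorem symJet_smul (z : Z) (t : ℝ) (A : SymForm E) : symJet E z (t • A) = t • symJet E z A := by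
  refine Prod.ext ?_ (Prod.ext ?_ rfl)
  · exact (smul_zero t (A := ℝ)).symm
  · exact (smul_zero t (A := E →L[ℝ] ℝ)).symm

theorem mem_jetSlice_of_smul_mem {F : Set (JetBundle E Z)} (hcone : HasConeProperty E F) {z : Z}
    {J : JetFiber E Z z} {t : ℝ} (ht : 0 < t) (h : t • J ∈ jetSlice E F z) :
    J ∈ jetSlice E F z := by
  have := hcone z _ h t⁻¹ (inv_pos.2 ht)
  rwa [smul_smul, inv_mul_cancel₀ ht.ne', one_smul] at this

set_option synthInstance.maxHeartbeats 200000 in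
/-- A form `P ≥ 0` whose kernel lies in a totally free subspace is interior. -/
theorem mem_interior_symSlice {F : Set (JetBundle E Z)} (hF : IsSubequation E F)
    (hcone : HasConeProperty E F) {z : Z} {W : Submodule ℝ E}
    (hW : IsTotallyFreeSubspace (symSlice E F z) W) {P : SymForm E}
    (hP : ∀ v, 0 ≤ P.1 v v) (hker : ∀ v, P.1 v v = 0 → v ∈ W) :
    P ∈ interior (symSlice E F z) := by
  obtain ⟨A, hAF, hA⟩ := hW
  obtain ⟨c, hc, ε, hε, h⟩ := exists_smul_sub_posDef hA hP hker
  have hcP : c • P ∈ interior (symSlice E F z) := by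
    refine mem_interior_of_norm_sub_lt hε fun B hB => ?_
    -- The lower bound on `c P - A` absorbs an error of norm less than `ε`, so `B - A ≥ 0`.
    have key : symJet E z A + symJet E z (B - A) ∈ jetSlice E F z := by
      refine hF.positivity z _ hAF _ fun v => ?_
      have h1 : |(B.1 - (c • P).1) v v| ≤ ε * ‖v‖ ^ 2 := by
        refine (ContinuousLinearMap.le_opNorm₂ (B.1 - (c • P).1) v v).trans ?_
        rw [mul_assoc, ← sq]
        gcongr
      have h2 := h v
      have h3 : (B.1 - (c • P).1) v v = B.1 v v - c * P.1 v v := rfl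
      rw [h3] at h1
      change 0 ≤ B.1 v v - A.1 v v
      linarith [(abs_le.1 h1).1]
    rw [← symJet_add] at key
    rwa [add_sub_cancel] at key
  refine mem_interior_of_smul_mem_interior hcP fun B hB' => ?_
  refine mem_jetSlice_of_smul_mem hcone hc ?_
  rw [← symJet_smul]
  exact hB'

/-- Fibrewise multiplication by `t` is continuous, and by the cone property the preimage of `Int F`
under it is an open subset of `F`. -/
theorem mem_interior_of_smul_mem {F : Set (JetBundle E Z)} (hcone : HasConeProperty E F) {z : Z}
    {J : JetFiber E Z z} {t : ℝ} (ht : 0 < t) (h : (⟨z, t • J⟩ : JetBundle E Z) ∈ interior F) :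
    (⟨z, J⟩ : JetBundle E Z) ∈ interior F := by
  have hmem : (⟨z, J⟩ : JetBundle E Z) ∈
      (fun p : JetBundle E Z => (⟨p.1, t • p.2⟩ : JetBundle E Z)) ⁻¹' interior F := h
  refine interior_maximal ?_ (isOpen_interior.preimage (continuous_jetBundle_smul t)) hmem
  rintro ⟨y, K⟩ hK
  exact mem_jetSlice_of_smul_mem hcone ht (interior_subset (s := F) hK)

end

/-! ### Slice charts of the submanifold and local extension -/

theorem hasMFDerivAt_comp_of_eq {E₁ E₂ E₃ M₁ M₂ M₃ : Type*} [NormedAddCommGroup E₁]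
    [NormedSpace ℝ E₁] [NormedAddCommGroup E₂] [NormedSpace ℝ E₂] [NormedAddCommGroup E₃]
    [NormedSpace ℝ E₃] [TopologicalSpace M₁] [ChartedSpace E₁ M₁] [TopologicalSpace M₂]
    [ChartedSpace E₂ M₂] [TopologicalSpace M₃] [ChartedSpace E₃ M₃] {f : M₁ → M₂} {g : M₂ → M₃}
    {x : M₁} {y : M₂} {f' : E₁ →L[ℝ] E₂} {g' : E₂ →L[ℝ] E₃}
    (hg : HasMFDerivAt 𝓘(ℝ, E₂) 𝓘(ℝ, E₃) g y g') (hf : HasMFDerivAt 𝓘(ℝ, E₁) 𝓘(ℝ, E₂) f x f')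
    (hy : f x = y) : HasMFDerivAt 𝓘(ℝ, E₁) 𝓘(ℝ, E₃) (g ∘ f) x (g'.comp f') := by
  subst hy
  exact HasMFDerivAt.comp x hg hf

section

variable {E : Type*} [NormedAddCommGroup E] [NormedSpace ℝ E]
  {Z : Type*} [TopologicalSpace Z] [ChartedSpace E Z]
  {E' : Type*} [NormedAddCommGroup E'] [NormedSpace ℝ E']
  {X : Type*} [TopologicalSpace X] [ChartedSpace E' X]
  {C : Type*} [NormedAddCommGroup C] [NormedSpace ℝ C]

/-- Tangent vectors and 2-jets at `z` are read in the same preferred chart, so kernels of Hessians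
can be compared with tangent spaces. -/
theorem mfderiv_eq_fderiv_chart {f : Z → C} {z : Z} (hf : MDifferentiableAt 𝓘(ℝ, E) 𝓘(ℝ, C) f z) :
    mfderiv 𝓘(ℝ, E) 𝓘(ℝ, C) f z = fderiv ℝ (f ∘ (chartAt E z).symm) (chartAt E z z) := by
  rw [hf.mfderiv]
  simp [mfld_simps, fderivWithin_univ]
  rfl

/-- In a slice chart `q` of a submanifold, with local retraction `ρ`, a vector with no normal
component is tangent to the submanifold. -/
theorem mem_range_mfderiv_of_slice {i : X → Z} {x : X} {q : Z → E' × C} {s : E' × C → Z}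
    {ρ : Z → X} (hi : MDifferentiableAt 𝓘(ℝ, E') 𝓘(ℝ, E) i x)
    (hq : MDifferentiableAt 𝓘(ℝ, E) 𝓘(ℝ, E' × C) q (i x))
    (hs : MDifferentiableAt 𝓘(ℝ, E' × C) 𝓘(ℝ, E) s (q (i x)))
    (hρ : MDifferentiableAt 𝓘(ℝ, E) 𝓘(ℝ, E') ρ (i x)) (hρx : ρ (i x) = x)
    (hsq : s ∘ q =ᶠ[𝓝 (i x)] id)
    (hslice : q ∘ i ∘ ρ =ᶠ[𝓝 (i x)] fun y => ((q y).1, 0)) {v : E}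
    (hv : (mfderiv 𝓘(ℝ, E) 𝓘(ℝ, E' × C) q (i x) v : E' × C).2 = 0) :
    v ∈ LinearMap.range (mfderiv 𝓘(ℝ, E') 𝓘(ℝ, E) i x).toLinearMap := by
  -- Differentiating the slice identity gives `Dq (Di (Dρ v)) = Dq v` when `v` has no normal
  -- component. Since `s ∘ q = id` makes `Dq` injective, `v = Di (Dρ v)`.
  have hir : HasMFDerivAt 𝓘(ℝ, E) 𝓘(ℝ, E) (i ∘ ρ) (i x)
      ((mfderiv 𝓘(ℝ, E') 𝓘(ℝ, E) i x).comp (mfderiv 𝓘(ℝ, E) 𝓘(ℝ, E') ρ (i x))) := by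
    exact hasMFDerivAt_comp_of_eq (E₁ := E) (E₂ := E') (E₃ := E) hi.hasMFDerivAt hρ.hasMFDerivAt hρx
  have h1 := hasMFDerivAt_comp_of_eq (E₁ := E) (E₂ := E) (E₃ := E' × C) hq.hasMFDerivAt hir (congrArg i hρx)
  let L : E' × C →L[ℝ] E' × C := (ContinuousLinearMap.fst ℝ E' C).prod 0
  have h2 := (L.hasMFDerivAt (x := q (i x))).comp (i x) hq.hasMFDerivAt
  have h3 := hasMFDerivAt_unique h1 (h2.congr_of_eventuallyEq hslice)
  have h4 := hasMFDerivAt_unique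
    ((hs.hasMFDerivAt.comp (i x) hq.hasMFDerivAt).congr_of_eventuallyEq hsq.symm)
    (hasMFDerivAt_id (i x))
  have h3v := congrArg (fun T => T v) h3
  have hL : L (mfderiv 𝓘(ℝ, E) 𝓘(ℝ, E' × C) q (i x) v) =
    mfderiv 𝓘(ℝ, E) 𝓘(ℝ, E' × C) q (i x) v := Prod.ext rfl hv.symm
  have h3v' : mfderiv 𝓘(ℝ, E) 𝓘(ℝ, E' × C) q (i x) (mfderiv 𝓘(ℝ, E') 𝓘(ℝ, E) i x
      (mfderiv 𝓘(ℝ, E) 𝓘(ℝ, E') ρ (i x) v)) = mfderiv 𝓘(ℝ, E) 𝓘(ℝ, E' × C) q (i x) v :=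
    h3v.trans hL
  have inv (w : E) : mfderiv 𝓘(ℝ, E' × C) 𝓘(ℝ, E) s (q (i x))
      (mfderiv 𝓘(ℝ, E) 𝓘(ℝ, E' × C) q (i x) w) = w := congrArg (fun T => T w) h4
  refine ⟨mfderiv 𝓘(ℝ, E) 𝓘(ℝ, E') ρ (i x) v, ?_⟩
  have h5 := congrArg (mfderiv 𝓘(ℝ, E' × C) 𝓘(ℝ, E) s (q (i x))) h3v'
  exact (inv _).symm.trans (h5.trans (inv v))

end

section

variable {E : Type*} [NormedAddCommGroup E] [NormedSpace ℝ E] [FiniteDimensional ℝ E]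
  {Z : Type*} [TopologicalSpace Z] [ChartedSpace E Z] [IsManifold 𝓘(ℝ, E) ∞ Z]
  {E' : Type*} [NormedAddCommGroup E'] [NormedSpace ℝ E']
  {X : Type*} [TopologicalSpace X] [ChartedSpace E' X]

variable (E) in
/-- The 2-jets `(0, 0, P)` at `z` with `P ≥ 0` and the kernel of `P` contained in `W`. -/
def normalJets (z : Z) (W : Submodule ℝ E) : Set (JetFiber E Z z) :=
  {J | ∃ P : SymForm E, J = symJet E z P ∧ (∀ v, 0 ≤ P.1 v v) ∧ ∀ v, P.1 v v = 0 → v ∈ W}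

theorem convex_normalJets (z : Z) (W : Submodule ℝ E) : Convex ℝ (normalJets E z W) := by
  rintro _ ⟨P, rfl, hP, hPW⟩ _ ⟨Q, rfl, hQ, hQW⟩ a b ha hb hab
  have eq (v : E) : (a • P + b • Q).1 v v = a * P.1 v v + b * Q.1 v v := rfl
  refine ⟨a • P + b • Q, ?_, fun v => ?_, fun v hv => ?_⟩
  · rw [symJet_add, symJet_smul, symJet_smul]
  · rw [eq]
    exact add_nonneg (mul_nonneg ha (hP v)) (mul_nonneg hb (hQ v))
  -- Both nonnegative summands vanish, and one of the weights is nonzero because they add up to `1`.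
  · rw [eq, add_eq_zero_iff_of_nonneg (mul_nonneg ha (hP v)) (mul_nonneg hb (hQ v))] at hv
    rcases mul_eq_zero.1 hv.1 with h | h
    · refine hQW v ((mul_eq_zero.1 hv.2).resolve_left ?_)
      rw [h, zero_add] at hab
      simp [hab]
    · exact hPW v h

/-- Near a point of an embedded submanifold, a `C²` function on the submanifold extends, and there
is a function vanishing on the submanifold whose Hessian is positive in normal directions. -/
theorem exists_local_extension {i : X → Z} (hi : IsSmoothEmbedding 𝓘(ℝ, E') 𝓘(ℝ, E) ∞ i)
    {u : X → ℝ} (hu : ContMDiff 𝓘(ℝ, E') 𝓘(ℝ, ℝ) 2 u) (x₀ : X) :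
    ∃ (W : Set Z) (w g : Z → ℝ), IsOpen W ∧ i x₀ ∈ W ∧
      ContMDiffOn 𝓘(ℝ, E) 𝓘(ℝ, ℝ) 2 w W ∧ ContMDiffOn 𝓘(ℝ, E) 𝓘(ℝ, ℝ) 2 g W ∧
      (∀ x, i x ∈ W → w (i x) = u x) ∧
      ∀ x, i x ∈ W → jetAt E g (i x) ∈ normalJets E (i x)
        (LinearMap.range (mfderiv 𝓘(ℝ, E') 𝓘(ℝ, E) i x).toLinearMap) := by
  have h := hi.isImmersion.isImmersionAt x₀
  have : FiniteDimensional ℝ (E' × h.complement) := h.equiv.symm.toLinearEquiv.finiteDimensional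
  have : FiniteDimensional ℝ h.complement :=
    FiniteDimensional.of_surjective (LinearMap.snd ℝ E' h.complement) LinearMap.snd_surjective
  set φ := h.codChart with hφ
  set ψ := h.domChart with hψ
  have hφa : φ ∈ IsManifold.maximalAtlas 𝓘(ℝ, E) 2 Z :=
    IsManifold.maximalAtlas_subset_of_le ENat.LEInfty.out h.codChart_mem_maximalAtlas
  have hψa : ψ ∈ IsManifold.maximalAtlas 𝓘(ℝ, E') 2 X :=
    IsManifold.maximalAtlas_subset_of_le ENat.LEInfty.out h.domChart_mem_maximalAtlas
  have hsrc : ∀ x ∈ ψ.source, i x ∈ φ.source := h.source_subset_preimage_source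
  -- Slice coordinates: in them `i` becomes `x ↦ (x, 0)`.
  let q : Z → E' × h.complement := fun z => h.equiv.symm (φ z)
  have hqi : ∀ x ∈ ψ.source, q (i x) = (ψ x, 0) := by
    intro x hx
    have hxt : ψ x ∈ (ψ.extend 𝓘(ℝ, E')).target := by simpa using ψ.map_source hx
    have := h.writtenInCharts hxt
    simp only [Function.comp_apply, OpenPartialHomeomorph.extend_coe,
      OpenPartialHomeomorph.extend_coe_symm, modelWithCornersSelf_coe,
      modelWithCornersSelf_coe_symm, id_eq, ← hψ, ← hφ, ψ.left_inv hx] at this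
    simp [q, this]
  have hq : ContMDiffOn 𝓘(ℝ, E) 𝓘(ℝ, E' × h.complement) 2 q φ.source :=
    h.equiv.symm.contDiff.contMDiff.comp_contMDiffOn (contMDiffOn_of_mem_maximalAtlas hφa)
  -- Here the embedding hypothesis enters: inside `V` the submanifold consists only of the sheet
  -- through `i x₀`, so no other part of it meets `W`.
  obtain ⟨V, hVo, hV⟩ := hi.isEmbedding.isInducing.isOpen_iff.1 ψ.open_source
  let W : Set Z := V ∩ (φ.source ∩ (fun z => (q z).1) ⁻¹' ψ.target)
  have hWo : IsOpen W := hVo.inter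
    ((continuous_fst.comp_continuousOn hq.continuousOn).isOpen_inter_preimage φ.open_source
      ψ.open_target)
  have hW : ∀ x, i x ∈ W → x ∈ ψ.source := by
    intro x hx
    rw [← hV]
    exact hx.1
  have hqW : ContMDiffOn 𝓘(ℝ, E) 𝓘(ℝ, E' × h.complement) 2 q W := hq.mono fun z hz => hz.2.1
  let ρ : Z → X := fun z => ψ.symm (q z).1
  have hρ : ContMDiffOn 𝓘(ℝ, E) 𝓘(ℝ, E') 2 ρ W :=
    (contMDiffOn_symm_of_mem_maximalAtlas hψa).comp
      (contDiff_fst.contMDiff.comp_contMDiffOn hqW) fun z hz => hz.2.2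
  have hρi : ∀ x ∈ ψ.source, ρ (i x) = x := by
    intro x hx
    simp [ρ, hqi x hx, ψ.left_inv hx]
  -- The complement carries just some norm; passing to a Euclidean space makes the squared norm of
  -- the normal coordinate smooth.
  let T := toEuclidean (E := h.complement)
  let N : Z → _ := fun z => T (q z).2
  have hN : ContMDiffOn 𝓘(ℝ, E) 𝓘(ℝ, _) 2 N W :=
    (T.contDiff.comp contDiff_snd).contMDiff.comp_contMDiffOn hqW
  refine ⟨W, u ∘ ρ, fun z => ‖N z‖ ^ 2, hWo, ⟨?_, ?_, ?_⟩, hu.comp_contMDiffOn hρ,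
    (contDiff_norm_sq ℝ).contMDiff.comp_contMDiffOn hN, fun x hx => ?_, fun x hx => ?_⟩
  · change x₀ ∈ i ⁻¹' V
    rw [hV]
    exact h.mem_domChart_source
  · exact h.mem_codChart_source
  · change (q (i x₀)).1 ∈ ψ.target
    rw [hqi x₀ h.mem_domChart_source]
    exact ψ.map_source h.mem_domChart_source
  · simp [hρi x (hW x hx)]
  · have hxψ := hW x hx
    have hWn := hWo.mem_nhds hx
    have hq' := hqW.contMDiffAt hWn
    have hqc := contDiffAt_comp_chart_symm hq' (chart_mem_atlas E (i x)) (mem_chart_source E (i x))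
    have hNc := contDiffAt_comp_chart_symm (hN.contMDiffAt hWn) (chart_mem_atlas E (i x))
      (mem_chart_source E (i x))
    obtain ⟨P, hJ, hP⟩ := coordJet_norm_sq hNc (by
      simp [N, (chartAt E (i x)).left_inv (mem_chart_source E (i x)), hqi x hxψ])
    refine ⟨P, hJ, fun v => ?_, fun v hv => ?_⟩
    · rw [hP]
      positivity
    · rw [hP] at hv
      have hv0 : fderiv ℝ (N ∘ (chartAt E (i x)).symm) (chartAt E (i x) (i x)) v = 0 := by
        simpa using hv
      have hd := ((T.hasFDerivAt.comp _ hasFDerivAt_snd).comp _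
        (hqc.differentiableAt (by simp)).hasFDerivAt).fderiv
      have hv1 : T (fderiv ℝ (q ∘ (chartAt E (i x)).symm) (chartAt E (i x) (i x)) v).2 = 0 := by
        rw [← hv0]
        exact (congrArg (fun A => A v) hd).symm
      have hsym : MDifferentiableAt 𝓘(ℝ, E' × h.complement) 𝓘(ℝ, E)
          (fun p => φ.symm (h.equiv p)) (q (i x)) := by
        have h1 := (contMDiffOn_symm_of_mem_maximalAtlas hφa).contMDiffAt
          (φ.open_target.mem_nhds (φ.map_source (hsrc x hxψ)))
        refine (ContMDiffAt.comp (I' := 𝓘(ℝ, E)) (g := φ.symm) (f := h.equiv) _ ?_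
          (h.equiv.contDiff.contMDiff _)).mdifferentiableAt (n := 2) (by simp)
        simpa [q] using h1
      refine mem_range_mfderiv_of_slice (q := q) (ρ := ρ)
        ((hi.contMDiff x).mdifferentiableAt (by simp))
        (hq'.mdifferentiableAt (by simp)) hsym ((hρ.contMDiffAt hWn).mdifferentiableAt (by simp))
        (hρi x hxψ) ?_ ?_ ?_
      · filter_upwards [hWn] with y hy
        simp [q, φ.left_inv hy.2.1]
      · filter_upwards [hWn] with y hy
        simp only [Function.comp_apply, ρ]
        rw [hqi _ (ψ.map_target hy.2.2), ψ.right_inv hy.2.2]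
      · rw [mfderiv_eq_fderiv_chart (hq'.mdifferentiableAt (by simp))]
        exact T.map_eq_zero_iff.1 hv1

end

/-! ### Gluing with partitions of unity -/

section

variable {E : Type*} [NormedAddCommGroup E] [NormedSpace ℝ E] [FiniteDimensional ℝ E]
  {Z : Type*} [TopologicalSpace Z] [T2Space Z] [SigmaCompactSpace Z]
  [ChartedSpace E Z] [IsManifold 𝓘(ℝ, E) ∞ Z]

/-- Gluing, with a partition of unity, of functions with prescribed 2-jets `(0, 0, A)` along a
closed set. -/
theorem exists_contMDiff_jetAt_mem {s : Set Z} (hs : IsClosed s) {S : ∀ z, Set (JetFiber E Z z)}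
    (hS : ∀ z, Convex ℝ (S z)) (hsym : ∀ z ∈ s, ∀ J ∈ S z, ∃ A, J = symJet E z A)
    (hloc : ∀ z ∈ s, ∃ (W : Set Z) (g : Z → ℝ), IsOpen W ∧ z ∈ W ∧
      ContMDiffOn 𝓘(ℝ, E) 𝓘(ℝ, ℝ) 2 g W ∧ ∀ y ∈ W ∩ s, jetAt E g y ∈ S y) :
    ∃ g : Z → ℝ, ContMDiff 𝓘(ℝ, E) 𝓘(ℝ, ℝ) 2 g ∧ ∀ z ∈ s, jetAt E g z ∈ S z := by
  choose! W g hWo hzW hg hJ using hloc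
  obtain ⟨f, hf⟩ := SmoothPartitionOfUnity.exists_isSubordinate 𝓘(ℝ, E) hs
    (fun z : s => W z) (fun z => hWo z z.2) (fun z hz => mem_iUnion.2 ⟨⟨z, hz⟩, hzW z hz⟩)
  refine ⟨fun y => ∑ᶠ j, f j y • g j y,
    hf.contMDiff_finsum_smul (fun z => hWo z z.2) fun z => hg z z.2, fun z hz => ?_⟩
  have hjW (j : s) (hj : j ∈ f.fintsupport z) : z ∈ W j :=
    hf j ((f.mem_fintsupport_iff z j).1 hj)
  have hgz (j : s) (hj : j ∈ f.fintsupport z) : ContMDiffAt 𝓘(ℝ, E) 𝓘(ℝ, ℝ) 2 (g j) z :=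
    (hg j j.2).contMDiffAt ((hWo j j.2).mem_nhds (hjW j hj))
  have hfz (j : s) : ContMDiffAt 𝓘(ℝ, E) 𝓘(ℝ, ℝ) 2 (f j) z :=
    (f j).contMDiff.contMDiffAt.of_le ENat.LEInfty.out
  have hev : (fun y => ∑ᶠ j, f j y • g j y) =ᶠ[𝓝 z]
      fun y => ∑ j ∈ f.fintsupport z, f j y * g j y := by
    filter_upwards [f.eventually_finsupport_subset z] with y hy
    refine finsum_eq_sum_of_support_subset _ fun j hj => hy ?_
    rw [f.mem_finsupport]
    exact left_ne_zero_of_smul hj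
  have hterm (j : s) (hj : j ∈ f.fintsupport z) :
      jetAt E (fun y => f j y * g j y) z = f j z • jetAt E (g j) z := by
    obtain ⟨A, hA⟩ := hsym z hz _ (hJ j j.2 z ⟨hjW j hj, hz⟩)
    exact jetAt_mul_of_critical (hfz j) (hgz j hj) hA
  rw [jetAt_congr hev, jetAt_sum (f := fun j y => f j y * g j y) _
    fun j hj => (hfz j).mul (hgz j hj), Finset.sum_congr rfl hterm]
  -- The partition functions add up to `1` on `s`, so the 2-jet is a convex combination of elements
  -- of `S z`.
  exact (hS z).sum_mem (fun j _ => f.nonneg j z)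
    (f.sum_finsupport' z hz (f.finsupport_subset_fintsupport z))
    fun j hj => hJ j j.2 z ⟨hjW j hj, hz⟩

variable {E' : Type*} [NormedAddCommGroup E'] [NormedSpace ℝ E']
  {X : Type*} [TopologicalSpace X] [ChartedSpace E' X]

theorem exists_contMDiff_extension {i : X → Z} (hi : IsSmoothEmbedding 𝓘(ℝ, E') 𝓘(ℝ, E) ∞ i)
    (hX : IsClosed (range i)) {u : X → ℝ} (hu : ContMDiff 𝓘(ℝ, E') 𝓘(ℝ, ℝ) 2 u) :
    ∃ w : Z → ℝ, ContMDiff 𝓘(ℝ, E) 𝓘(ℝ, ℝ) 2 w ∧ ∀ x, w (i x) = u x := by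
  -- The constraint is void off the range, which is closed, so there the zero function serves as
  -- local solution.
  let t : Z → Set ℝ := fun z => {c | ∀ x, i x = z → c = u x}
  have ht (z : Z) : Convex ℝ (t z) := by
    intro a ha b hb p q _ _ hpq x hx
    rw [ha x hx, hb x hx, ← add_smul, hpq, one_smul]
  have hloc (z : Z) : ∃ W ∈ 𝓝 z, ∃ w : Z → ℝ,
      ContMDiffOn 𝓘(ℝ, E) 𝓘(ℝ, ℝ) 2 w W ∧ ∀ y ∈ W, w y ∈ t y := by
    by_cases hz : z ∈ range i
    · obtain ⟨x₀, rfl⟩ := hz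
      obtain ⟨W, w, g, hWo, hxW, hw, -, hwu, -⟩ := exists_local_extension hi hu x₀
      exact ⟨W, hWo.mem_nhds hxW, w, hw, fun y hy x hx => hx ▸ hwu x (hx ▸ hy)⟩
    · exact ⟨(range i)ᶜ, hX.isOpen_compl.mem_nhds hz, fun _ => 0, contMDiffOn_const,
        fun y hy x hx => absurd ⟨x, hx⟩ hy⟩
  obtain ⟨w, hw⟩ := exists_contMDiffMap_forall_mem_convex_of_local (n := 2) 𝓘(ℝ, E) ht hloc
  exact ⟨w, w.contMDiff, fun x => hw (i x) x rfl⟩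

/-- A substitute for the square of the distance to a closed embedded submanifold. -/
theorem exists_contMDiff_normalJets {i : X → Z} (hi : IsSmoothEmbedding 𝓘(ℝ, E') 𝓘(ℝ, E) ∞ i)
    (hX : IsClosed (range i)) :
    ∃ g : Z → ℝ, ContMDiff 𝓘(ℝ, E) 𝓘(ℝ, ℝ) 2 g ∧ ∀ x, jetAt E g (i x) ∈ normalJets E (i x)
      (LinearMap.range (mfderiv 𝓘(ℝ, E') 𝓘(ℝ, E) i x).toLinearMap) := by
  let S : ∀ z : Z, Set (JetFiber E Z z) := fun z => {J | ∀ x, i x = z → J ∈ normalJets E z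
    (LinearMap.range (mfderiv 𝓘(ℝ, E') 𝓘(ℝ, E) i x).toLinearMap)}
  have hS (z : Z) : Convex ℝ (S z) := fun J hJ K hK a b ha hb hab x hx =>
    convex_normalJets z _ (hJ x hx) (hK x hx) ha hb hab
  have hsym : ∀ z ∈ range i, ∀ J ∈ S z, ∃ A, J = symJet E z A := by
    rintro _ ⟨x, rfl⟩ J hJ
    obtain ⟨P, hP, -⟩ := hJ x rfl
    exact ⟨P, hP⟩
  have hloc : ∀ z ∈ range i, ∃ (W : Set Z) (g : Z → ℝ), IsOpen W ∧ z ∈ W ∧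
      ContMDiffOn 𝓘(ℝ, E) 𝓘(ℝ, ℝ) 2 g W ∧ ∀ y ∈ W ∩ range i, jetAt E g y ∈ S y := by
    rintro _ ⟨x₀, rfl⟩
    obtain ⟨W, w, g, hWo, hxW, -, hg, -, hgJ⟩ :=
      exists_local_extension hi (u := fun _ => 0) contMDiff_const x₀
    refine ⟨W, g, hWo, hxW, hg, fun y hy x hx => ?_⟩
    subst hx
    exact hgJ x hy.1
  obtain ⟨g, hg, hJ⟩ := exists_contMDiff_jetAt_mem hX hS hsym hloc
  exact ⟨g, hg, fun x => hJ (i x) ⟨x, rfl⟩ x rfl⟩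

/-- If the 2-jets `J_z(w)` and `P_z = J_z(g)` are such that `P_z` is interior to the cone bundle `F`
along a closed set, then so is `J_z(w) + l P_z` for a suitable smooth function `l`. -/
theorem exists_contMDiff_add_smul_jetAt_mem {F : Set (JetBundle E Z)} (hcone : HasConeProperty E F)
    {s : Set Z} (hs : IsClosed s) {w g : Z → ℝ} (hw : ContMDiff 𝓘(ℝ, E) 𝓘(ℝ, ℝ) 2 w)
    (hg : ContMDiff 𝓘(ℝ, E) 𝓘(ℝ, ℝ) 2 g)
    (hgF : ∀ z ∈ s, (⟨z, jetAt E g z⟩ : JetBundle E Z) ∈ interior F) :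
    ∃ l : Z → ℝ, ContMDiff 𝓘(ℝ, E) 𝓘(ℝ, ℝ) 2 l ∧
      ∀ z ∈ s, (⟨z, jetAt E w z + l z • jetAt E g z⟩ : JetBundle E Z) ∈ interior F := by
  -- Requiring every `b ≥ a` to work makes `t z` an upper set, hence convex, so local constants can
  -- be glued.
  let t : Z → Set ℝ := fun z => {a | z ∈ s → ∀ b ≥ a,
    (⟨z, jetAt E w z + b • jetAt E g z⟩ : JetBundle E Z) ∈ interior F}
  have ht (z : Z) : Convex ℝ (t z) := by
    have hup : IsUpperSet (t z) := fun a b hab ha hz c hc => ha hz c (hab.trans hc)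
    exact hup.ordConnected.convex
  have hloc (z : Z) : ∃ a : ℝ, ∀ᶠ y in 𝓝 z, a ∈ t y := by
    by_cases hz : z ∈ s
    · have hcont := (continuous_smul_jetAt_add_jetAt hw hg).continuousAt (x := ((0 : ℝ), z))
      have h0 : (⟨z, (0 : ℝ) • jetAt E w z + jetAt E g z⟩ : JetBundle E Z) ∈ interior F := by
        rw [zero_smul, zero_add]
        exact hgF z hz
      have hev := hcont.eventually (isOpen_interior.mem_nhds h0)
      rw [nhds_prod_eq] at hev
      obtain ⟨p, hp, r, hr, hpr⟩ := Filter.eventually_prod_iff.1 hev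
      obtain ⟨ε, hε, hball⟩ := Metric.eventually_nhds_iff.1 hp
      -- For `b ≥ 2 / ε` one has `b⁻¹ ≤ ε / 2 < ε`, so `b⁻¹ J(w) + J(g)` is in `Int F`; scaling by
      -- `b` then stays in it.
      refine ⟨2 / ε, hr.mono fun y hy _ b hb => ?_⟩
      have hb0 : 0 < b := (div_pos two_pos hε).trans_le hb
      have hbε : dist b⁻¹ 0 < ε := by
        rw [Real.dist_0_eq_abs, abs_of_pos (inv_pos.2 hb0)]
        have := inv_anti₀ (div_pos two_pos hε) hb
        rw [inv_div] at this
        linarith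
      refine mem_interior_of_smul_mem hcone (inv_pos.2 hb0) ?_
      have := hpr (hball hbε) hy
      rwa [smul_add, smul_smul, inv_mul_cancel₀ hb0.ne', one_smul]
    · refine ⟨0, ?_⟩
      filter_upwards [hs.isOpen_compl.mem_nhds hz] with y hy hys using absurd hys hy
  obtain ⟨l, hl⟩ := exists_contMDiffMap_forall_mem_convex_of_local_const (n := 2) 𝓘(ℝ, E) ht hloc
  exact ⟨l, l.contMDiff, fun z hz => hl z hz _ le_rfl⟩

end

/-! ### The extension theorem -/

theorem theoremC3
    {E : Type*} [NormedAddCommGroup E] [NormedSpace ℝ E] [FiniteDimensional ℝ E]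
    {Z : Type*} [TopologicalSpace Z] [T2Space Z] [SecondCountableTopology Z]
    [ChartedSpace E Z] [IsManifold 𝓘(ℝ, E) ∞ Z]
    {E' : Type*} [NormedAddCommGroup E'] [NormedSpace ℝ E'] [FiniteDimensional ℝ E']
    {X : Type*} [TopologicalSpace X] [ChartedSpace E' X] [IsManifold 𝓘(ℝ, E') ∞ X]
    (i : X → Z) (hi : Manifold.IsSmoothEmbedding 𝓘(ℝ, E') 𝓘(ℝ, E) ∞ i)
    (hX : IsClosed (Set.range i))
    (F : Set (JetBundle E Z)) (hF : IsSubequation E F) (hcone : HasConeProperty E F)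
    (hint : ∀ x : X, ∀ A ∈ interior (symSlice E F (i x)),
      (⟨i x, symJet E (i x) A⟩ : JetBundle E Z) ∈ interior F)
    (hfree : IsTotallyFree E F (E' := E') i)
    (u : X → ℝ) (hu : ContMDiff 𝓘(ℝ, E') 𝓘(ℝ, ℝ) 2 u) :
    ∃ (U : Set Z) (f : Z → ℝ), IsOpen U ∧ Set.range i ⊆ U ∧
      IsStrictlySubharmonicOn E F f U ∧ ∀ x : X, f (i x) = u x := by
  -- With second countability this gives the σ-compactness used for partitions of unity.
  have : LocallyCompactSpace Z := ChartedSpace.locallyCompactSpace E Z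
  obtain ⟨w, hw, hwu⟩ := exists_contMDiff_extension hi hX hu
  obtain ⟨g, hg, hgJ⟩ := exists_contMDiff_normalJets hi hX
  have hgF : ∀ z ∈ range i, (⟨z, jetAt E g z⟩ : JetBundle E Z) ∈ interior F := by
    rintro _ ⟨x, rfl⟩
    obtain ⟨P, hJ, hP, hker⟩ := hgJ x
    rw [hJ]
    exact hint x P (mem_interior_symSlice hF hcone (hfree x) hP hker)
  obtain ⟨l, hl, hlF⟩ := exists_contMDiff_add_smul_jetAt_mem hcone hX hw hg hgF
  have hf : ContMDiff 𝓘(ℝ, E) 𝓘(ℝ, ℝ) 2 (fun z => w z + l z * g z) := hw.add (hl.mul hg)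
  refine ⟨{z | (⟨z, jetAt E (fun z => w z + l z * g z) z⟩ : JetBundle E Z) ∈ interior F},
    fun z => w z + l z * g z, isOpen_interior.preimage (continuous_jetAt hf), ?_,
    ⟨hf.contMDiffOn, fun z hz => hz⟩, fun x => ?_⟩
  · rintro _ ⟨x, rfl⟩
    obtain ⟨P, hJ, -⟩ := hgJ x
    -- As `g` has critical value zero on the submanifold, the derivatives of `l` do not contribute.
    have h1 := jetAt_mul_of_critical (hl (i x)) (hg (i x)) hJ
    have h2 : jetAt E (fun z => w z + l z * g z) (i x) =
        jetAt E w (i x) + jetAt E (fun z => l z * g z) (i x) :=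
      jetAt_add (hw (i x)) ((hl (i x)).mul (hg (i x)))
    have h3 := hlF (i x) ⟨x, rfl⟩
    rw [← h1] at h3
    rw [← h2] at h3
    exact h3
  · obtain ⟨P, hJ, -⟩ := hgJ x
    simp [eq_zero_of_jetAt_eq_symJet hJ, hwu]
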